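/- A Krein space $(\mathcal K,[\cdot,\cdot])$ is a complex vector space with a Hermitian non-degenerate sesquilinear form (linear in the first variable) that admits a direct, $[\cdot,\cdot]$-orthogonal decomposition $\mathcal K=\mathcal K_+\,[\dotplus]\,\mathcal K_-$ such that $(\mathcal K_+,[\cdot,\cdot])$ and $(\mathcal K_-,-[\cdot,\cdot])$ are Hilbert spaces; its topology is the one induced by the Hilbert space inner product $(x,y)=[x_+,y_+]-[x_-,y_-]$. A bounded operator $A$ in $\mathcal K$ is called non-negative if $[Ax,y]=[x,Ay]$ for all $x,y\in\mathcal K$, $\rho(A)\neq\emptyset$, and $[Ax,x]\ge 0$ for all $x\in\mathcal K$. Let $A$ be a bounded non-negative operator in the Krein space $(\mathcal K,[\cdot,\cdot])$. On the quotient space $\mathcal K_0:=\mathcal K/\ker A$ put $$\langle [x],[y]\rangle := [Ax,y]\quad\text{and}\quad A_0[x]:=[Ax],\qquad x,y\in\mathcal K.$$ Then $\langle\cdot,\cdot\rangle$ and $A_0$ are well defined, $(\mathcal K_0,\langle\cdot,\cdot\rangle)$ is a pre-Hilbert space (i.e. $\langle\cdot,\cdot\rangle$ is a positive definite inner product), and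 the operator $A_0$ is bounded and symmetric in $(\mathcal K_0,\langle\cdot,\cdot\rangle)$. Consequently $A_0$ has a unique bounded extension $\widetilde A$ to the completion $\widetilde{\mathcal K}$ of $(\mathcal K_0,\langle\cdot,\cdot\rangle)$, and $\widetilde A$ is selfadjoint. Moreover, $$\sigma(\widetilde A)\setminus\{0\}=\sigma(A)\setminus\{0\},$$ and $0\in\rho(\widetilde A)$ if and only if either $0\in\rho(A)$ or zero is an isolated eigenvalue of $A$ (an eigenvalue that is an isolated point of $\sigma(A)$) such that $\ker A=\ker A^2$. -/

import Mathlib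

open scoped ComplexConjugate

noncomputable section

/-- Sesquilinear forms `[x, y]` on a complex vector space, linear in `x` and conjugate linear
in `y`. -/
abbrev KSesqForm (K : Type*) [AddCommGroup K] [Module ℂ K] : Type _ := K →ₗ[ℂ] K →ₗ⋆[ℂ] ℂ

/-- `(W, B)` is a Hilbert space: `B` restricts to an inner product on the subspace `W`, and `W` is
complete in the induced norm. Mathlib's inner products are conjugate linear in the first variable,
hence the exchange of the variables. -/
def KSesqForm.IsHilbertOn {K : Type*} [AddCommGroup K] [Module ℂ K] (B : KSesqForm K)
    (W : Submodule ℂ K) : Prop :=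
  ∃ c : InnerProductSpace.Core ℂ W, (∀ x y : W, c.inner y x = B x y) ∧
    @CompleteSpace W c.toNormedAddCommGroup.toUniformSpace

/-- A fundamental decomposition `K = K₊ [∔] K₋` of a complex vector space with a sesquilinear
form `B`: a direct, `B`-orthogonal sum such that `(K₊, B)` and `(K₋, -B)` are Hilbert spaces. -/
structure FundamentalDecomposition {K : Type*} [AddCommGroup K] [Module ℂ K]
    (B : KSesqForm K) where
  /-- The subspace `K₊`. -/
  pos : Submodule ℂ K
  /-- The subspace `K₋`. -/
  neg : Submodule ℂ K
  isCompl : IsCompl pos neg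
  orthogonal : ∀ x ∈ pos, ∀ y ∈ neg, B x y = 0
  hilbert_pos : B.IsHilbertOn pos
  hilbert_neg : KSesqForm.IsHilbertOn (-B) neg

namespace FundamentalDecomposition

variable {K : Type*} [AddCommGroup K] [Module ℂ K] {B : KSesqForm K}

/-- The component `x₊` of `x = x₊ + x₋`. -/
def posPart (D : FundamentalDecomposition B) : K →ₗ[ℂ] K :=
  D.pos.projection D.neg D.isCompl

/-- The component `x₋` of `x = x₊ + x₋`. -/
def negPart (D : FundamentalDecomposition B) : K →ₗ[ℂ] K :=
  D.neg.projection D.pos D.isCompl.symm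

/-- The definite inner product `(x, y) = [x₊, y₊] - [x₋, y₋]` on `K` (in Mathlib's order of the
variables). -/
@[reducible] def core (D : FundamentalDecomposition B) : InnerProductSpace.Core ℂ K where
  inner x y := B (D.posPart y) (D.posPart x) - B (D.negPart y) (D.negPart x)
  conj_inner_symm x y := by
    obtain ⟨c, hc, -⟩ := D.hilbert_pos
    obtain ⟨d, hd, -⟩ := D.hilbert_neg
    have h1 := c.conj_inner_symm (D.pos.projectionOnto D.neg D.isCompl x)
      (D.pos.projectionOnto D.neg D.isCompl y)
    have h2 := d.conj_inner_symm (D.neg.projectionOnto D.pos D.isCompl.symm x)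
      (D.neg.projectionOnto D.pos D.isCompl.symm y)
    rw [hc, hc] at h1
    rw [hd, hd] at h2
    simp only [LinearMap.neg_apply, map_neg, neg_inj] at h2
    rw [map_sub]
    exact congrArg₂ (· - ·) h1 h2
  re_inner_nonneg x := by
    obtain ⟨c, hc, -⟩ := D.hilbert_pos
    obtain ⟨d, hd, -⟩ := D.hilbert_neg
    have h1 := c.re_inner_nonneg (D.pos.projectionOnto D.neg D.isCompl x)
    have h2 := d.re_inner_nonneg (D.neg.projectionOnto D.pos D.isCompl.symm x)
    rw [hc] at h1
    rw [hd] at h2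
    simp only [LinearMap.neg_apply, map_neg] at h2
    rw [map_sub, sub_eq_add_neg]
    exact add_nonneg h1 h2
  add_left x y z := by simp only [map_add]; ring
  smul_left x y r := by simp only [map_smulₛₗ, smul_eq_mul, RingHom.id_apply]; ring
  definite x hx := by
    obtain ⟨c, hc, -⟩ := D.hilbert_pos
    obtain ⟨d, hd, -⟩ := D.hilbert_neg
    set p := D.pos.projectionOnto D.neg D.isCompl x with hp
    set n := D.neg.projectionOnto D.pos D.isCompl.symm x with hn
    have h1 := c.re_inner_nonneg p
    have h2 := d.re_inner_nonneg n
    have e1 : c.inner p p = B (D.posPart x) (D.posPart x) := hc p p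
    have e2 : d.inner n n = -B (D.negPart x) (D.negPart x) := hd n n
    have hs : c.inner p p + d.inner n n = 0 := by rw [e1, e2, ← sub_eq_add_neg]; exact hx
    have i1 : RCLike.im (c.inner p p) = 0 := RCLike.conj_eq_iff_im.1 (c.conj_inner_symm p p)
    have i2 : RCLike.im (d.inner n n) = 0 := RCLike.conj_eq_iff_im.1 (d.conj_inner_symm n n)
    have hr : RCLike.re (c.inner p p) + RCLike.re (d.inner n n) = 0 := by
      rw [← map_add, hs, map_zero]
    have hp0 : p = 0 := c.definite p (RCLike.ext (by rw [map_zero]; linarith) (by rw [map_zero, i1]))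
    have hn0 : n = 0 := d.definite n (RCLike.ext (by rw [map_zero]; linarith) (by rw [map_zero, i2]))
    have m1 : x ∈ D.neg := (Submodule.projectionOnto_apply_eq_zero_iff D.isCompl).1 hp0
    have m2 : x ∈ D.pos := (Submodule.projectionOnto_apply_eq_zero_iff D.isCompl.symm).1 hn0
    exact (Submodule.disjoint_def.1 D.isCompl.disjoint) x m2 m1

/-- The topology of the Hilbert space norm `‖x‖ = (x, x) ^ (1 / 2)` on `K` that is induced by a
fundamental decomposition. -/
@[reducible] def topology (D : FundamentalDecomposition B) : TopologicalSpace K :=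
  D.core.toNormedAddCommGroup.toUniformSpace.toTopologicalSpace

end FundamentalDecomposition

/-- A Krein space: a complex vector space with a Hermitian non-degenerate sesquilinear form that
admits a fundamental decomposition, equipped with the topology induced by a fundamental
decomposition (they all induce the same one). -/
class KreinSpace (K : Type*) [AddCommGroup K] [Module ℂ K] [τ : TopologicalSpace K] where
  /-- The Krein space inner product `[x, y]`. -/
  form : KSesqForm K
  hermitian : ∀ x y, conj (form y x) = form x y
  nondegenerate : ∀ x, (∀ y, form x y = 0) → x = 0
  exists_decomposition : ∃ D : FundamentalDecomposition form, τ = D.topology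

instance KreinSpace.isTopologicalAddGroup (K : Type*) [AddCommGroup K] [Module ℂ K]
    [TopologicalSpace K] [h : KreinSpace K] : IsTopologicalAddGroup K := by
  obtain ⟨D, hD⟩ := h.exists_decomposition
  rw [hD]
  exact @SeminormedAddCommGroup.toIsTopologicalAddGroup K
    D.core.toNormedAddCommGroup.toSeminormedAddCommGroup

instance KreinSpace.continuousSMul (K : Type*) [AddCommGroup K] [Module ℂ K]
    [TopologicalSpace K] [h : KreinSpace K] : ContinuousSMul ℂ K := by
  obtain ⟨D, hD⟩ := h.exists_decomposition
  rw [hD]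
  let _ := D.core.toNormedAddCommGroup
  let N : NormedSpace ℂ K := InnerProductSpace.Core.toNormedSpace (c := D.core.toCore)
  exact @IsBoundedSMul.continuousSMul ℂ K _ _ _ _ _ N.toIsBoundedSMul

/-- Bounded non-negative operators in a Krein space: selfadjoint with respect to `[·, ·]`, with
non-empty resolvent set, and with `[Ax, x] ≥ 0` for all `x` (this number is real because `A` is
selfadjoint). -/
structure IsKreinNonneg {K : Type*} [AddCommGroup K] [Module ℂ K] [TopologicalSpace K]
    [KreinSpace K] (A : K →L[ℂ] K) : Prop where
  selfAdjoint : ∀ x y, KreinSpace.form (A x) y = KreinSpace.form x (A y)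
  resolventSet_nonempty : (resolventSet ℂ A).Nonempty
  nonneg : ∀ x, 0 ≤ (KreinSpace.form (A x) x).re

/-- `μ` is an isolated eigenvalue of `A`: an eigenvalue that is an isolated point of `σ(A)`. -/
def IsIsolatedEigenvalue {K : Type*} [AddCommGroup K] [Module ℂ K] [TopologicalSpace K]
    [IsTopologicalAddGroup K] [ContinuousSMul ℂ K] (A : K →L[ℂ] K) (μ : ℂ) : Prop :=
  Module.End.HasEigenvalue (A : K →ₗ[ℂ] K) μ ∧ ∃ U ∈ nhds μ, U ∩ spectrum ℂ A = {μ}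

/-- The vector space `K₀ = K / ker A`. It is a type of its own, so that it does not carry the
quotient topology of `K`. -/
def KerQuotient {K : Type*} [AddCommGroup K] [Module ℂ K] [TopologicalSpace K]
    (A : K →L[ℂ] K) : Type _ :=
  K ⧸ LinearMap.ker (A : K →ₗ[ℂ] K)

namespace KerQuotient

variable {K : Type*} [AddCommGroup K] [Module ℂ K] [TopologicalSpace K] (A : K →L[ℂ] K)

instance : AddCommGroup (KerQuotient A) :=
  inferInstanceAs (AddCommGroup (K ⧸ LinearMap.ker (A : K →ₗ[ℂ] K)))

instance : Module ℂ (KerQuotient A) :=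
  inferInstanceAs (Module ℂ (K ⧸ LinearMap.ker (A : K →ₗ[ℂ] K)))

/-- The class `[x]` of `x` in `K / ker A`. -/
def mk : K →ₗ[ℂ] KerQuotient A :=
  (LinearMap.ker (A : K →ₗ[ℂ] K)).mkQ

end KerQuotient

end

open scoped ComplexConjugate

/-! ### Spectra of `B ∘L C` and `C ∘L B` -/

section Factorization

variable {K H : Type*} [NormedAddCommGroup K] [NormedSpace ℂ K] [NormedAddCommGroup H]

/-! A fundamental symmetry J turns the form into the Hilbert space product: [x, y] = (Jx, y). Since
[Ax, x] = (JAx, x) ≤ ‖JA‖‖x‖², the quotient map gives a bounded C from K to the completion with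
dense range and C*C = JA. With B = JC* this factors A = BC, while CB = CJC* is selfadjoint and sends
the class of x to that of Ax, so CB is the required extension.

The spectra of BC and CB agree off zero for any bounded B and C (`spectrum_comp_comm_diff_zero`). At
zero, B is injective because C has dense range, so ker A = ker C. If CB is invertible, either C is
injective and A is invertible, or zero is isolated in σ(A) and A² has no larger kernel. Conversely,
an isolated zero gives the selfadjoint CB a generalized inverse (`exists_commute_mul_mul_eq_self`),
which ker A = ker A² makes a true inverse. -/

theorem isUnit_algebraMap_sub_comp_comm [NormedSpace ℂ H] (C : K →L[ℂ] H)
    (B : H →L[ℂ] K) {z : ℂ} (hz : z ≠ 0)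
    (h : IsUnit (algebraMap ℂ (K →L[ℂ] K) z - B ∘L C)) :
    IsUnit (algebraMap ℂ (H →L[ℂ] H) z - C ∘L B) := by
  rw [Algebra.algebraMap_eq_smul_one] at h ⊢
  obtain ⟨S, h1, h2⟩ := isUnit_iff_exists.1 h
  have e1 : ∀ x, z • S x - B (C (S x)) = x := fun x => congrArg (fun T : K →L[ℂ] K => T x) h1
  have e2 : ∀ x, S (z • x - B (C x)) = x := fun x => congrArg (fun T : K →L[ℂ] K => T x) h2
  -- Suggested by the formal Neumann series: (z - CB)⁻¹ = z⁻¹(1 + C(z - BC)⁻¹B).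
  refine isUnit_iff_exists.2 ⟨z⁻¹ • (1 + C ∘L S ∘L B), ?_, ?_⟩
  · ext u
    change z • (z⁻¹ • (u + C (S (B u)))) - C (B (z⁻¹ • (u + C (S (B u))))) = u
    have : C (B (C (S (B u)))) = z • C (S (B u)) - C (B u) := by
      rw [← map_smul, ← map_sub]
      exact congrArg C (eq_sub_of_add_eq' (sub_eq_iff_eq_add.1 (e1 (B u))).symm)
    rw [map_smul, map_add, map_smul, map_add, this, add_sub_cancel, inv_smul_smul₀ hz,
      smul_inv_smul₀ hz, add_sub_cancel_right]
  · ext u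
    change z⁻¹ • (z • u - C (B u) + C (S (B (z • u - C (B u))))) = u
    rw [map_sub B, map_smul B, e2, sub_add_cancel, inv_smul_smul₀ hz]

theorem spectrum_comp_comm_diff_zero [NormedSpace ℂ H] (C : K →L[ℂ] H) (B : H →L[ℂ] K) :
    spectrum ℂ (C ∘L B) \ {0} = spectrum ℂ (B ∘L C) \ {0} := by
  ext z
  refine and_congr_left fun hz => not_congr ⟨?_, ?_⟩
  · exact isUnit_algebraMap_sub_comp_comm B C hz
  · exact isUnit_algebraMap_sub_comp_comm C B hz

/-- With S = (BC)⁻¹, the operator CSB fixes the range of C, hence by density everything; this makes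
CS²B the inverse of CB. -/
theorem isUnit_comp_comm_of_denseRange [NormedSpace ℂ H] {C : K →L[ℂ] H}
    {B : H →L[ℂ] K} (hC : DenseRange C)
    (h : IsUnit (B ∘L C)) : IsUnit (C ∘L B) := by
  obtain ⟨S, h1, h2⟩ := isUnit_iff_exists.1 h
  have e1 : ∀ x, B (C (S x)) = x := fun x => congrArg (fun T : K →L[ℂ] K => T x) h1
  have e2 : ∀ x, S (B (C x)) = x := fun x => congrArg (fun T : K →L[ℂ] K => T x) h2
  have e3 : ∀ u, C (S (B u)) = u := congrFun <| hC.equalizer (by fun_prop) (by fun_prop) <|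
    funext fun x => congrArg C (e2 x)
  refine isUnit_iff_exists.2 ⟨C ∘L S ∘L S ∘L B, ?_, ?_⟩
  · ext u
    change C (B (C (S (S (B u))))) = u
    rw [e1, e3]
  · ext u
    change C (S (S (B (C (B u))))) = u
    rw [e2, e3]

/-- With S = (CB)⁻¹, cancelling C in C(BSC) = C gives BSC = 1; this makes BS²C the inverse of BC. -/
theorem isUnit_of_isUnit_comp_comm_of_injective [NormedSpace ℂ H] {C : K →L[ℂ] H} {B : H →L[ℂ] K}
    (hC : Function.Injective C) (h : IsUnit (C ∘L B)) : IsUnit (B ∘L C) := by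
  obtain ⟨S, h1, h2⟩ := isUnit_iff_exists.1 h
  have e1 : ∀ x, C (B (S x)) = x := fun x => congrArg (fun T : H →L[ℂ] H => T x) h1
  have e2 : ∀ x, S (C (B x)) = x := fun x => congrArg (fun T : H →L[ℂ] H => T x) h2
  have e3 : ∀ x, B (S (C x)) = x := fun x => hC (e1 _)
  refine isUnit_iff_exists.2 ⟨B ∘L S ∘L S ∘L C, ?_, ?_⟩
  · ext x
    change B (C (B (S (S (C x))))) = x
    rw [e1, e3]
  · ext x
    change B (S (S (C (B (C x))))) = x
    rw [e2, e3]

theorem zero_mem_resolventSet_iff {R : Type*} [Ring R] [Algebra ℂ R] {a : R} :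
    (0 : ℂ) ∈ resolventSet ℂ a ↔ IsUnit a := by
  rw [spectrum.mem_resolventSet_iff, map_zero, zero_sub, IsUnit.neg_iff]

/-- A selfadjoint operator whose spectrum meets a neighbourhood of zero at most in zero has a
bounded generalized inverse that commutes with it. -/
theorem exists_commute_mul_mul_eq_self {R : Type*} [CStarAlgebra R] {T : R}
    (hT : IsSelfAdjoint T) {U : Set ℂ} (hU : U ∈ nhds 0) (h : U ∩ spectrum ℂ T ⊆ {0}) :
    ∃ Q : R, Q * T = T * Q ∧ T * (T * Q) = T := by
  have : IsStarNormal T := hT.isStarNormal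
  -- The convention 0⁻¹ = 0 does no harm: zero is at most an isolated point of the spectrum. The
  -- functional calculus then applies, and z(z z⁻¹) = z holds even at zero.
  have hc : ContinuousOn (fun z : ℂ => z⁻¹) (spectrum ℂ T) := by
    intro z hz
    rcases eq_or_ne z 0 with rfl | hz0
    · have : (fun z : ℂ => z⁻¹) =ᶠ[nhdsWithin 0 (spectrum ℂ T)] fun _ => 0 := by
        filter_upwards [mem_nhdsWithin_of_mem_nhds hU, self_mem_nhdsWithin] with w h1 h2
        simp [Set.mem_singleton_iff.1 (h ⟨h1, h2⟩)]
      exact continuousWithinAt_const.congr_of_eventuallyEq this (by simp)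
    · exact (continuousAt_inv₀ hz0).continuousWithinAt
  have hid : cfc (fun z : ℂ => z) T = T := cfc_id' ℂ T
  refine ⟨cfc (fun z : ℂ => z⁻¹) T, ?_, ?_⟩
  · have := (cfc_commute_cfc (fun z : ℂ => z⁻¹) (fun z : ℂ => z) T).eq
    rwa [hid] at this
  · have h1 : T * cfc (fun z : ℂ => z⁻¹) T = cfc (fun z : ℂ => z * z⁻¹) T := by
      rw [cfc_mul (fun z : ℂ => z) (fun z : ℂ => z⁻¹) T continuousOn_id hc, hid]
    have h2 : T * cfc (fun z : ℂ => z * z⁻¹) T = cfc (fun z : ℂ => z * (z * z⁻¹)) T := by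
      rw [cfc_mul (fun z : ℂ => z) (fun z : ℂ => z * z⁻¹) T continuousOn_id
        (continuousOn_id.mul hc), hid]
    rw [h1, h2]
    refine Eq.trans (congrArg (cfc · T) (funext fun z => ?_)) hid
    rcases eq_or_ne z 0 with rfl | hz
    · simp
    · field_simp

/-- If `A = BC` and `CB` is selfadjoint, then `CB` is invertible if and only if `A` is invertible or
zero is an isolated eigenvalue of `A` without Jordan chains of length two. -/
theorem zero_mem_resolventSet_comp_comm_iff [InnerProductSpace ℂ H] [CompleteSpace H]
    {C : K →L[ℂ] H} {B : H →L[ℂ] K} {A : K →L[ℂ] K} (hA : A = B ∘L C)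
    (hC : DenseRange C) (hB : Function.Injective B) (hs : IsSelfAdjoint (C ∘L B)) :
    (0 : ℂ) ∈ resolventSet ℂ (C ∘L B) ↔ (0 : ℂ) ∈ resolventSet ℂ A ∨
      (IsIsolatedEigenvalue A 0 ∧
        LinearMap.ker (A : K →ₗ[ℂ] K) = LinearMap.ker ((A * A : K →L[ℂ] K) : K →ₗ[ℂ] K)) := by
  subst hA
  have hsp := spectrum_comp_comm_diff_zero C B
  have hker : ∀ x, B (C x) = 0 → C x = 0 := fun x hx => hB (hx.trans (map_zero B).symm)
  constructor
  · intro h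
    by_cases hinj : Function.Injective C
    · rw [zero_mem_resolventSet_iff] at h ⊢
      exact Or.inl (isUnit_of_isUnit_comp_comm_of_injective hinj h)
    · obtain ⟨x, hx, hx0⟩ : ∃ x, C x = 0 ∧ x ≠ 0 := by
        simpa [injective_iff_map_eq_zero] using hinj
      have hev : Module.End.HasEigenvalue ((B ∘L C : K →L[ℂ] K) : K →ₗ[ℂ] K) 0 :=
        Module.End.hasEigenvalue_of_hasEigenvector (x := x)
          ⟨Module.End.mem_eigenspace_iff.2 (by simp [hx]), hx0⟩
      have hmem : (0 : ℂ) ∈ spectrum ℂ (B ∘L C) := fun h0 => hx0 <| by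
        obtain ⟨S, -, h2⟩ := isUnit_iff_exists.1 (zero_mem_resolventSet_iff.1 h0)
        have e2 : S (B (C x)) = x := congrArg (fun T : K →L[ℂ] K => T x) h2
        rw [← e2, hx, map_zero, map_zero]
      refine Or.inr ⟨⟨hev, _, (spectrum.isOpen_resolventSet _).mem_nhds h, ?_⟩, ?_⟩
      · refine Set.eq_singleton_iff_unique_mem.2 ⟨⟨h, hmem⟩, fun z hz => by_contra fun hz0 => ?_⟩
        exact (hsp.symm.subset ⟨hz.2, hz0⟩).1 hz.1
      · ext y
        change B (C y) = 0 ↔ B (C (B (C y))) = 0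
        refine ⟨fun hy => by rw [hy, map_zero, map_zero], fun hy => ?_⟩
        obtain ⟨S, -, h2⟩ := isUnit_iff_exists.1 (zero_mem_resolventSet_iff.1 h)
        have e2 : S (C (B (C y))) = C y := congrArg (fun T : H →L[ℂ] H => T (C y)) h2
        rw [← e2, hker _ hy, map_zero, map_zero]
  · rintro (h | ⟨⟨-, U, hU, h⟩, hk⟩)
    · rw [zero_mem_resolventSet_iff] at h ⊢
      exact isUnit_comp_comm_of_denseRange hC h
    · have hUs : U ∩ spectrum ℂ (C ∘L B) ⊆ {0} := fun z hz => by_contra fun hz0 =>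
        hz0 (h.subset ⟨hz.1, (hsp.subset ⟨hz.2, hz0⟩).1⟩)
      obtain ⟨Q, hQ1, hQ2⟩ := exists_commute_mul_mul_eq_self hs hU hUs
      -- From T²Q = T with T = CB, the vector x - BQCx lies in ker A² = ker A = ker C. Thus TQ = 1
      -- on the dense range of C.
      have hE : ∀ x, C x = C (B (Q (C x))) := fun x => by
        have e : C (B (C (B (Q (C x))))) = C (B (C x)) :=
          congrArg (fun T : H →L[ℂ] H => T (C x)) hQ2
        have hmem : x - B (Q (C x)) ∈
            LinearMap.ker (((B ∘L C) * (B ∘L C) : K →L[ℂ] K) : K →ₗ[ℂ] K) := by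
          change B (C (B (C (x - B (Q (C x)))))) = 0
          simp only [map_sub, e, sub_self, map_zero]
        rw [← hk] at hmem
        rw [← sub_eq_zero, ← map_sub]
        exact hker _ hmem
      have h1 : C ∘L B * Q = 1 := ContinuousLinearMap.ext <| congrFun <|
        hC.equalizer (ContinuousLinearMap.continuous _) (ContinuousLinearMap.continuous _) <|
        funext fun x => (hE x).symm
      rw [zero_mem_resolventSet_iff]
      exact isUnit_iff_exists.2 ⟨Q, h1, hQ1.trans h1⟩

end Factorization

/-! ### The extension as `C ∘L J ∘L C.adjoint` -/

section
open InnerProductSpace UniformSpace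

/-- Let `J` be a selfadjoint involution of a Hilbert space `K`, and let `q : K → V` be a surjection
onto an inner product space that turns the form `(JAx, y)` into the inner product. Then `A` induces
a bounded symmetric operator on `V`, whose selfadjoint extension to the completion of `V` has the
same non-zero spectrum as `A`. -/
theorem exists_extension_of_inner_eq {K V : Type*} [NormedAddCommGroup K] [InnerProductSpace ℂ K]
    [CompleteSpace K] [NormedAddCommGroup V] [InnerProductSpace ℂ V] (A J : K →L[ℂ] K)
    (hJ : ∀ x, J (J x) = x) (hJs : IsSelfAdjoint J) (q : K →ₗ[ℂ] V)
    (hq : Function.Surjective q) (hi : ∀ x y, inner ℂ (q y) (q x) = inner ℂ y (J (A x))) :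
    ∃ A₀ : V →L[ℂ] V, (∀ x : K, A₀ (q x) = q (A x)) ∧ (A₀ : V →ₗ[ℂ] V).IsSymmetric ∧
      ∃ At : Completion V →L[ℂ] Completion V,
        (∀ u : V, At (u : Completion V) = (A₀ u : Completion V)) ∧
        (∀ T : Completion V →L[ℂ] Completion V,
          (∀ u : V, T (u : Completion V) = (A₀ u : Completion V)) → T = At) ∧
        IsSelfAdjoint At ∧
        spectrum ℂ At \ {0} = spectrum ℂ A \ {0} ∧
        ((0 : ℂ) ∈ resolventSet ℂ At ↔ (0 : ℂ) ∈ resolventSet ℂ A ∨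
          (IsIsolatedEigenvalue A 0 ∧ LinearMap.ker (A : K →ₗ[ℂ] K) =
            LinearMap.ker ((A * A : K →L[ℂ] K) : K →ₗ[ℂ] K))) := by
  have hbound : ∀ x, ‖q x‖ ≤ √‖J ∘L A‖ * ‖x‖ := fun x => by
    refine abs_le_of_sq_le_sq' ?_ (by positivity) |>.2
    rw [mul_pow, Real.sq_sqrt (norm_nonneg _), ← inner_self_eq_norm_sq (𝕜 := ℂ), hi]
    calc _ ≤ ‖x‖ * ‖J (A x)‖ := re_inner_le_norm _ _
      _ ≤ ‖x‖ * (‖J ∘L A‖ * ‖x‖) := by gcongr; exact (J ∘L A).le_opNorm x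
      _ = _ := by ring
  let C : K →L[ℂ] Completion V := Completion.toComplL ∘L q.mkContinuous _ hbound
  have hCq : ∀ x, C x = (q x : Completion V) := fun _ => rfl
  have hC : DenseRange C := (Completion.denseRange_coe (α := V)).comp hq.denseRange
    (Completion.continuous_coe V)
  let B : Completion V →L[ℂ] K := J ∘L C.adjoint
  have hCC : ∀ x, C.adjoint (C x) = J (A x) := fun x => by
    refine ext_inner_left ℂ fun y => ?_
    rw [ContinuousLinearMap.adjoint_inner_right, hCq, hCq, Completion.inner_coe, hi]
  have hBC : ∀ x, B (C x) = A x := fun x => by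
    change J (C.adjoint (C x)) = A x
    rw [hCC, hJ]
  have hA : A = B ∘L C := ContinuousLinearMap.ext fun x => (hBC x).symm
  have hB : Function.Injective B := (injective_iff_map_eq_zero B).2 fun u hu => by
    have h0 : C.adjoint u = 0 := by rw [← hJ (C.adjoint u)]; exact (congrArg J hu).trans (map_zero J)
    have : ∀ w, inner ℂ w u = 0 := congrFun <| hC.equalizer (by fun_prop) (by fun_prop) <|
      funext fun x => by
        change inner ℂ (C x) u = 0
        rw [← ContinuousLinearMap.adjoint_inner_right, h0, inner_zero_right]
    exact inner_self_eq_zero.1 (this u)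
  have hs : IsSelfAdjoint (C ∘L B) := hJs.conj_adjoint C
  have hmk : ∀ x, C (B (q x : Completion V)) = (q (A x) : Completion V) := fun x => by
    rw [← hCq, ← hCq, hBC]
  choose r hr using hq
  -- Well-definedness is inherited from CB, which already acts on classes.
  have hker : ∀ x y, q x = q y → q (A x) = q (A y) := fun x y h => by
    apply Completion.coe_injective V
    rw [← hmk, ← hmk, h]
  let L : V →ₗ[ℂ] V :=
    { toFun u := q (A (r u))
      map_add' u v := by
        rw [← map_add, ← map_add]; exact hker _ _ (by simp only [map_add, hr])
      map_smul' c u := by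
        rw [← map_smul, ← map_smul]; exact hker _ _ (by simp only [map_smul, hr, RingHom.id_apply]) }
  have hL : ∀ u : V, (L u : Completion V) = (C ∘L B) u := fun u => by
    refine (hmk _).symm.trans ?_
    rw [hr]; rfl
  refine ⟨L.mkContinuous ‖C ∘L B‖ fun u => ?_, fun x => hker _ _ (hr _), ?_, C ∘L B, ?_, ?_, hs,
    hA ▸ spectrum_comp_comm_diff_zero C B, zero_mem_resolventSet_comp_comm_iff hA hC hB hs⟩
  · rw [← Completion.norm_coe, hL, ← Completion.norm_coe u]
    exact (C ∘L B).le_opNorm _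
  · intro u v
    change inner ℂ (L u) v = inner ℂ u (L v)
    rw [← Completion.inner_coe (L u) v, ← Completion.inner_coe u (L v), hL, hL]
    exact (ContinuousLinearMap.isSelfAdjoint_iff_isSymmetric.1 hs) _ _
  · exact fun u => (hL u).symm
  · intro T hT
    refine ContinuousLinearMap.ext <| congrFun <| (Completion.denseRange_coe (α := V)).equalizer
      (ContinuousLinearMap.continuous _) (ContinuousLinearMap.continuous _) <| funext fun u => ?_
    exact (hT u).trans (hL u)

end

/-! ### Krein space geometry and the quotient inner product -/

section

/-- A normed space that is an orthogonal sum of two complete ones is complete. -/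
theorem completeSpace_of_prod_linearEquiv {K P N : Type*} [NormedAddCommGroup K] [NormedSpace ℂ K]
    [NormedAddCommGroup P] [NormedSpace ℂ P] [CompleteSpace P]
    [NormedAddCommGroup N] [NormedSpace ℂ N] [CompleteSpace N] (e : (P × N) ≃ₗ[ℂ] K)
    (h : ∀ p n, ‖e (p, n)‖ ^ 2 = ‖p‖ ^ 2 + ‖n‖ ^ 2) : CompleteSpace K := by
  -- The product carries the sup norm, so √2 would suffice; 2 avoids the root.
  have h1 : ∀ x, ‖e x‖ ≤ 2 * ‖x‖ := fun x => by
    refine abs_le_of_sq_le_sq' ?_ (by positivity) |>.2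
    have := h x.1 x.2
    nlinarith [norm_fst_le x, norm_snd_le x, norm_nonneg x.1, norm_nonneg x.2, norm_nonneg x]
  have h2 : ∀ x, ‖x‖ ≤ ‖e x‖ := fun x => by
    have := h x.1 x.2
    refine max_le ?_ ?_ <;> refine abs_le_of_sq_le_sq' ?_ (by positivity) |>.2 <;>
      nlinarith [sq_nonneg ‖x.1‖, sq_nonneg ‖x.2‖]
  let E := e.toContinuousLinearEquivOfBounds 2 1 h1 fun y => by
    simpa using h2 (e.symm y)
  exact (completeSpace_congr (e := E.toEquiv) E.isUniformEmbedding).1 inferInstance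

namespace FundamentalDecomposition

variable {K : Type*} [AddCommGroup K] [Module ℂ K] {B : KSesqForm K}

theorem posPart_add (D : FundamentalDecomposition B) (p : D.pos) (n : D.neg) :
    D.posPart (p + n) = p := by
  simp [posPart]

theorem negPart_add (D : FundamentalDecomposition B) (p : D.pos) (n : D.neg) :
    D.negPart (p + n) = n := by
  simp [negPart]

theorem exists_eq_add (D : FundamentalDecomposition B) (x : K) :
    ∃ (p : D.pos) (n : D.neg), (p + n : K) = x :=
  let ⟨y, hy⟩ := (Submodule.prodEquivOfIsCompl D.pos D.neg D.isCompl).surjective x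
  ⟨y.1, y.2, hy⟩

theorem core_inner_add (D : FundamentalDecomposition B) (p p' : D.pos) (n n' : D.neg) :
    D.core.inner (p + n : K) (p' + n' : K) = B p' p - B n' n := by
  change B (D.posPart _) (D.posPart _) - B (D.negPart _) (D.negPart _) = _
  simp only [posPart_add, negPart_add]

theorem completeSpace (D : FundamentalDecomposition B) :
    @CompleteSpace K D.core.toNormedAddCommGroup.toUniformSpace := by
  obtain ⟨c, hc, hc'⟩ := D.hilbert_pos
  obtain ⟨d, hd, hd'⟩ := D.hilbert_neg
  let NP := c.toNormedAddCommGroup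
  let NN := d.toNormedAddCommGroup
  let IP : InnerProductSpace ℂ D.pos := InnerProductSpace.ofCore c.toCore
  let IN : InnerProductSpace ℂ D.neg := InnerProductSpace.ofCore d.toCore
  have hp : ∀ p : D.pos, ‖p‖ ^ 2 = (B p p).re := fun p =>
    (IP.norm_sq_eq_re_inner p).trans (congrArg Complex.re (hc p p))
  have hn : ∀ n : D.neg, ‖n‖ ^ 2 = (-B n n).re := fun n =>
    (IN.norm_sq_eq_re_inner n).trans (congrArg Complex.re (hd n n))
  let NK := D.core.toNormedAddCommGroup
  let IK : InnerProductSpace ℂ K := InnerProductSpace.ofCore D.core.toCore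
  refine @completeSpace_of_prod_linearEquiv K D.pos D.neg NK IK.toNormedSpace NP IP.toNormedSpace hc'
    NN IN.toNormedSpace hd' (Submodule.prodEquivOfIsCompl D.pos D.neg D.isCompl) fun p n => ?_
  have hk : ‖(p + n : K)‖ ^ 2 = (D.core.inner (p + n : K) (p + n : K)).re :=
    IK.norm_sq_eq_re_inner (p + n : K)
  rw [core_inner_add] at hk
  refine hk.trans ?_
  rw [hp, hn, sub_eq_add_neg, Complex.add_re]

/-- The fundamental symmetry `x ↦ x₊ - x₋`. -/
noncomputable def symmetry (D : FundamentalDecomposition B) : K →ₗ[ℂ] K := D.posPart - D.negPart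

theorem symmetry_add (D : FundamentalDecomposition B) (p : D.pos) (n : D.neg) :
    D.symmetry (p + n) = p - n := by
  simp only [symmetry, LinearMap.sub_apply, posPart_add, negPart_add]

theorem symmetry_add' (D : FundamentalDecomposition B) (p : D.pos) (n : D.neg) :
    D.symmetry (p + n) = p + (-n : D.neg) := by
  rw [symmetry_add, sub_eq_add_neg, Submodule.coe_neg]

theorem symmetry_symmetry (D : FundamentalDecomposition B) (x : K) :
    D.symmetry (D.symmetry x) = x := by
  obtain ⟨p, n, rfl⟩ := D.exists_eq_add x
  rw [symmetry_add', symmetry_add', neg_neg]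

/-- Orthogonality kills the cross terms of the form, and the sign in the symmetry undoes the sign on
the negative part. -/
theorem core_inner_symmetry (D : FundamentalDecomposition B) (hB : ∀ x y, conj (B y x) = B x y)
    (x y : K) : D.core.inner y (D.symmetry x) = B x y := by
  obtain ⟨p, n, rfl⟩ := D.exists_eq_add x
  obtain ⟨p', n', rfl⟩ := D.exists_eq_add y
  have h1 : B p n' = 0 := D.orthogonal _ p.2 _ n'.2
  have h2 : B n p' = 0 := by rw [← hB, D.orthogonal _ p'.2 _ n.2, map_zero]
  rw [symmetry_add', core_inner_add]
  simp [h1, h2]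

theorem core_inner_symmetry_symmetry (D : FundamentalDecomposition B) (x y : K) :
    D.core.inner (D.symmetry y) (D.symmetry x) = D.core.inner y x := by
  obtain ⟨p, n, rfl⟩ := D.exists_eq_add x
  obtain ⟨p', n', rfl⟩ := D.exists_eq_add y
  rw [symmetry_add', symmetry_add', core_inner_add, core_inner_add]
  simp

end FundamentalDecomposition

/-- The positive definite inner product `⟨[x], [y]⟩ = [Ax, y]` on `K / ker A`. -/
theorem KerQuotient.exists_core {K : Type*} [AddCommGroup K] [Module ℂ K] [TopologicalSpace K]
    {B : KSesqForm K} (hB : ∀ x y, conj (B y x) = B x y) (hnd : ∀ x, (∀ y, B x y = 0) → x = 0)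
    (A : K →L[ℂ] K) (hsa : ∀ x y, B (A x) y = B x (A y)) (hpos : ∀ x, 0 ≤ (B (A x) x).re) :
    ∃ c : InnerProductSpace.Core ℂ (KerQuotient A),
      ∀ x y : K, c.inner (KerQuotient.mk A y) (KerQuotient.mk A x) = B (A x) y := by
  have hsurj : Function.Surjective (KerQuotient.mk A) := Submodule.mkQ_surjective _
  choose r hr using hsurj
  have hconj : ∀ x y, conj (B (A y) x) = B (A x) y := fun x y => by rw [hB, hsa]
  have hl : ∀ x x' y, KerQuotient.mk A x = KerQuotient.mk A x' → B (A x) y = B (A x') y :=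
    fun x x' y h => by
      have : x - x' ∈ LinearMap.ker (A : K →ₗ[ℂ] K) := (Submodule.Quotient.eq _).1 h
      have : A x = A x' := sub_eq_zero.1 ((map_sub A x x').symm.trans this)
      rw [this]
  have hr2 : ∀ x y v, KerQuotient.mk A x = v → B (A y) (r v) = B (A y) x := fun x y v h => by
    rw [← hconj, hl _ x _ ((hr v).trans h.symm), hconj]
  have hwd : ∀ x y, B (A (r (KerQuotient.mk A x))) (r (KerQuotient.mk A y)) = B (A x) y :=
    fun x y => by rw [hl _ x _ (hr _), hr2 y _ _ rfl]
  let p : PreInnerProductSpace.Core ℂ K :=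
    { inner x y := B (A y) x
      conj_inner_symm x y := hconj y x
      re_inner_nonneg := hpos
      add_left x y z := by simp only [map_add]
      smul_left x y z := by simp only [map_smulₛₗ, smul_eq_mul] }
  -- Cauchy–Schwarz for the semidefinite form gives |[Ax, y]|² ≤ [Ax, x][Ay, y], so Ax is orthogonal
  -- to everything.
  have hzero : ∀ x, B (A x) x = 0 → A x = 0 := fun x hx => hnd _ fun y => by
    have h : ‖B (A y) x‖ * ‖B (A x) y‖ ≤ (B (A x) x).re * (B (A y) y).re :=
      InnerProductSpace.Core.inner_mul_inner_self_le (c := p) x y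
    rw [hx, Complex.zero_re, zero_mul, ← hconj y x, RCLike.norm_conj] at h
    exact norm_eq_zero.1 (mul_self_eq_zero.1 (h.antisymm (mul_self_nonneg _)))
  refine ⟨
    { inner u v := B (A (r v)) (r u)
      conj_inner_symm u v := hconj _ _
      re_inner_nonneg u := hpos _
      add_left := ?_
      smul_left := ?_
      definite := ?_ }, hwd⟩
  · intro u v w
    rw [hr2 (r u + r v) _ _ (by rw [map_add, hr, hr]), map_add]
  · intro u v z
    rw [hr2 (z • r u) _ _ (by rw [map_smul, hr]), map_smulₛₗ, smul_eq_mul]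
  · intro u hu
    rw [← hr u]
    exact (Submodule.Quotient.mk_eq_zero _).2 (hzero _ hu)

/-- The main theorem for a Hermitian form with a given fundamental decomposition. -/
theorem exists_quotient_extension {K : Type*} [AddCommGroup K] [Module ℂ K] [τ : TopologicalSpace K]
    [IsTopologicalAddGroup K] [ContinuousSMul ℂ K]
    {B : KSesqForm K} (hB : ∀ x y, conj (B y x) = B x y) (hnd : ∀ x, (∀ y, B x y = 0) → x = 0)
    (D : FundamentalDecomposition B) (hτ : τ = D.topology)
    (A : K →L[ℂ] K) (hsa : ∀ x y, B (A x) y = B x (A y)) (hpos : ∀ x, 0 ≤ (B (A x) x).re) :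
    ∃ c : InnerProductSpace.Core ℂ (KerQuotient A),
      (∀ x y : K, c.inner (KerQuotient.mk A y) (KerQuotient.mk A x) = B (A x) y) ∧
      letI : NormedAddCommGroup (KerQuotient A) := c.toNormedAddCommGroup
      letI : InnerProductSpace ℂ (KerQuotient A) := InnerProductSpace.ofCore c.toCore
      ∃ A₀ : KerQuotient A →L[ℂ] KerQuotient A,
        (∀ x : K, A₀ (KerQuotient.mk A x) = KerQuotient.mk A (A x)) ∧
        (A₀ : KerQuotient A →ₗ[ℂ] KerQuotient A).IsSymmetric ∧
        ∃ At : UniformSpace.Completion (KerQuotient A) →L[ℂ]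
            UniformSpace.Completion (KerQuotient A),
          (∀ u : KerQuotient A, At (u : UniformSpace.Completion (KerQuotient A)) =
            (A₀ u : UniformSpace.Completion (KerQuotient A))) ∧
          (∀ T : UniformSpace.Completion (KerQuotient A) →L[ℂ]
              UniformSpace.Completion (KerQuotient A),
            (∀ u : KerQuotient A, T (u : UniformSpace.Completion (KerQuotient A)) =
              (A₀ u : UniformSpace.Completion (KerQuotient A))) → T = At) ∧
          IsSelfAdjoint At ∧
          spectrum ℂ At \ {0} = spectrum ℂ A \ {0} ∧
          ((0 : ℂ) ∈ resolventSet ℂ At ↔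
            (0 : ℂ) ∈ resolventSet ℂ A ∨
              (IsIsolatedEigenvalue A 0 ∧
                LinearMap.ker (A : K →ₗ[ℂ] K) =
                  LinearMap.ker ((A * A : K →L[ℂ] K) : K →ₗ[ℂ] K))) := by
  obtain ⟨c, hc⟩ := KerQuotient.exists_core hB hnd A hsa hpos
  refine ⟨c, hc, ?_⟩
  subst hτ
  let NK := D.core.toNormedAddCommGroup
  let IK : InnerProductSpace ℂ K := InnerProductSpace.ofCore D.core.toCore
  have hK : CompleteSpace K := D.completeSpace
  have hn : ∀ x, ‖D.symmetry x‖ ≤ 1 * ‖x‖ := fun x => by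
    rw [one_mul]
    refine abs_le_of_sq_le_sq' ?_ (norm_nonneg x) |>.2
    refine ((IK.norm_sq_eq_re_inner _).trans ?_).trans_le (IK.norm_sq_eq_re_inner x).ge
    exact congrArg Complex.re (D.core_inner_symmetry_symmetry x x)
  let J : K →L[ℂ] K := D.symmetry.mkContinuous 1 hn
  have hJ : ∀ x, J (J x) = x := D.symmetry_symmetry
  -- An involution preserving the inner product is symmetric: (Jx, y) = (Jx, JJy) = (x, Jy).
  have hJs : IsSelfAdjoint J := ContinuousLinearMap.isSelfAdjoint_iff_isSymmetric.2 fun x y => by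
    have := D.core_inner_symmetry_symmetry (D.symmetry y) x
    rwa [D.symmetry_symmetry] at this
  let NV : NormedAddCommGroup (KerQuotient A) := c.toNormedAddCommGroup
  let IV : InnerProductSpace ℂ (KerQuotient A) := InnerProductSpace.ofCore c.toCore
  exact exists_extension_of_inner_eq (V := KerQuotient A) A J hJ hJs (KerQuotient.mk A)
    (Submodule.mkQ_surjective _) fun x y => (hc x y).trans (D.core_inner_symmetry hB (A x) y).symm

end

theorem mainTheorem4 {K : Type*} [AddCommGroup K] [Module ℂ K] [TopologicalSpace K]
    [KreinSpace K] (A : K →L[ℂ] K) (hA : IsKreinNonneg A) :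
    -- `⟨[x], [y]⟩ := [Ax, y]` is a well-defined (positive definite) inner product on `K / ker A`
    ∃ c : InnerProductSpace.Core ℂ (KerQuotient A),
      (∀ x y : K, c.inner (KerQuotient.mk A y) (KerQuotient.mk A x) = KreinSpace.form (A x) y) ∧
      letI : NormedAddCommGroup (KerQuotient A) := c.toNormedAddCommGroup
      letI : InnerProductSpace ℂ (KerQuotient A) := InnerProductSpace.ofCore c.toCore
      -- `A₀ [x] := [Ax]` is a well-defined bounded symmetric operator
      ∃ A₀ : KerQuotient A →L[ℂ] KerQuotient A,
        (∀ x : K, A₀ (KerQuotient.mk A x) = KerQuotient.mk A (A x)) ∧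
        (A₀ : KerQuotient A →ₗ[ℂ] KerQuotient A).IsSymmetric ∧
        -- its unique bounded extension to the completion is selfadjoint
        ∃ At : UniformSpace.Completion (KerQuotient A) →L[ℂ]
            UniformSpace.Completion (KerQuotient A),
          (∀ u : KerQuotient A, At (u : UniformSpace.Completion (KerQuotient A)) =
            (A₀ u : UniformSpace.Completion (KerQuotient A))) ∧
          (∀ T : UniformSpace.Completion (KerQuotient A) →L[ℂ]
              UniformSpace.Completion (KerQuotient A),
            (∀ u : KerQuotient A, T (u : UniformSpace.Completion (KerQuotient A)) =
              (A₀ u : UniformSpace.Completion (KerQuotient A))) → T = At) ∧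
          IsSelfAdjoint At ∧
          spectrum ℂ At \ {0} = spectrum ℂ A \ {0} ∧
          ((0 : ℂ) ∈ resolventSet ℂ At ↔
            (0 : ℂ) ∈ resolventSet ℂ A ∨
              (IsIsolatedEigenvalue A 0 ∧
                LinearMap.ker (A : K →ₗ[ℂ] K) =
                  LinearMap.ker ((A * A : K →L[ℂ] K) : K →ₗ[ℂ] K))) := by
  obtain ⟨D, hD⟩ := KreinSpace.exists_decomposition (K := K)
  exact exists_quotient_extension KreinSpace.hermitian KreinSpace.nondegenerate D hD A
    hA.selfAdjoint hA.nonneg
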